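/- Let $N\ge 2$ and $k\ge 0$ be integers. Let $e_1,\dots,e_N$ be the standard basis of $\mathbb{R}^N$ with its standard inner product $(\cdot,\cdot)$. Let $\omega_i=e_1+\cdots+e_i-\frac{i}{N}(e_1+\cdots+e_N)$, $1\le i\le N-1$, be the fundamental weights of $\mathfrak{su}(N)$, let $\Delta_+=\{e_a-e_b: 1\le a<b\le N\}$ be the set of positive roots, $\rho=\frac12\sum_{\alpha\in\Delta_+}\alpha$ the Weyl vector, and $W=\mathfrak{S}_N$ the Weyl group, acting by permutation of coordinates, with $\det(w)=\pm1$ the sign of $w$. Let $P_+^k$ be the finite set of level-$k$ integrable dominant weights of $\widehat{\mathfrak{su}}(N)$, i.e. of $\lambda=\sum_{i=1}^{N-1}\lambda_i\omega_i$ with $\lambda_i\in\mathbb{Z}_{\ge0}$ and $\lambda_1+\cdots+\lambda_{N-1}\le k$. The modular $S$-matrix of the $\widehat{\mathfrak{su}}(N)_k$ WZW model is given by the Kac--Peterson formula $$S_{\lambda\mu}=\frac{i^{|\Delta_+|}}{\sqrt{N}\,(k+N)^{(N-1)/2}}\sum_{w\in W}\det(w)\exp\left(-\frac{2\pi i}{k+N}\bigl(\lambda+\rho,\,w(\mu+\rho)\bigr)\right),\qquad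 \lambda,\mu\in P_+^k .$$ Then $S$ is unitary: for all $\lambda,\nu\in P_+^k$, $$\sum_{\mu\in P_+^k} S_{\lambda\mu}\overline{S_{\nu\mu}}=\delta_{\lambda\nu}.$$ -/

import Mathlib

open scoped BigOperators

noncomputable section

namespace SuAffine

/-- Level-`k` integrable dominant weights of affine `su(N)`, given by the finite Dynkin labels
`l = (l_1, …, l_{N-1})`, nonnegative integers with `l_1 + ⋯ + l_{N-1} ≤ k`
(`l i` is the label of index `i + 1`). -/
abbrev LevelWeight (N k : ℕ) : Type :=
  {l : Fin (N - 1) → ℕ // ∑ i, l i ≤ k}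

theorem finite_levelWeight (N k : ℕ) : Finite (LevelWeight N k) := by
  have h : {l : Fin (N - 1) → ℕ | ∑ i, l i ≤ k}.Finite := by
    refine (Set.finite_Iic (fun _ : Fin (N - 1) => k)).subset ?_
    intro l hl i
    exact (Finset.single_le_sum (f := l) (fun j _ => Nat.zero_le _) (Finset.mem_univ i)).trans hl
  exact h.to_subtype

instance (N k : ℕ) : Fintype (LevelWeight N k) :=
  haveI := finite_levelWeight N k
  Fintype.ofFinite _

/-- The index pairs `(a, b)`, `a < b`, of the positive roots `e_a - e_b` of `su(N)`. -/
def posRootIndices (N : ℕ) : Finset (Fin N × Fin N) :=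
  Finset.univ.filter fun p => p.1 < p.2

/-- The root `e_a - e_b`. Weights of `su(N)` are realised as vectors of `ℝ^N` with coordinate
sum zero, and the invariant form, for which roots have squared length 2, is the dot product. -/
def root (N : ℕ) (p : Fin N × Fin N) : Fin N → ℝ :=
  Pi.single p.1 1 - Pi.single p.2 1

/-- The Weyl vector: half the sum of the positive roots. -/
def weylVector (N : ℕ) : Fin N → ℝ :=
  (1 / 2 : ℝ) • ∑ p ∈ posRootIndices N, root N p

/-- The fundamental weight `ω_{i+1} = e_1 + ⋯ + e_{i+1} - ((i+1)/N) (e_1 + ⋯ + e_N)`. -/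
def fundamentalWeight (N : ℕ) (i : Fin (N - 1)) : Fin N → ℝ :=
  fun j => (if (j : ℕ) ≤ (i : ℕ) then 1 else 0) - ((i : ℝ) + 1) / (N : ℝ)

/-- The weight `∑ i, l_i ω_i` with Dynkin labels `l`. -/
def weightVector {N k : ℕ} (l : LevelWeight N k) : Fin N → ℝ :=
  ∑ i, (l.1 i : ℝ) • fundamentalWeight N i

/-- The Weyl group of `su(N)` is the symmetric group, permuting the coordinates of `ℝ^N`
(the transposition of `a` and `b` is the reflection in the root `e_a - e_b`);
the determinant of a permutation is its sign. -/
def weylAct {N : ℕ} (w : Equiv.Perm (Fin N)) (x : Fin N → ℝ) : Fin N → ℝ :=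
  fun j => x (w⁻¹ j)

/-- The Kac–Peterson normalisation `i^{|Δ₊|} |P/Q^∨|^{-1/2} (k+N)^{-r/2}`, where the weight
lattice modulo the (co)root lattice has `N` elements and the rank is `r = N - 1`. -/
def kacPetersonConst (N k : ℕ) : ℂ :=
  Complex.I ^ (posRootIndices N).card /
    ((Real.sqrt N * Real.sqrt ((k : ℝ) + N) ^ (N - 1) : ℝ) : ℂ)

/-- The Kac–Peterson modular `S`-matrix of the level-`k` `su(N)` Wess–Zumino–Witten model. -/
def kacPetersonS (N k : ℕ) : Matrix (LevelWeight N k) (LevelWeight N k) ℂ :=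
  fun l m =>
    kacPetersonConst N k *
      ∑ w : Equiv.Perm (Fin N), ((Equiv.Perm.sign w : ℤ) : ℂ) *
        Complex.exp (-(2 * (Real.pi : ℂ) * Complex.I / ((k : ℂ) + (N : ℂ))) *
          (((weightVector l + weylVector N) ⬝ᵥ
            weylAct w (weightVector m + weylVector N) : ℝ) : ℂ))

end SuAffine

end

namespace SuAffine
open Finset

/-! Write `h = k + N`. Up to a multiple of `(1, …, 1)`, `λ + ρ` is the tuple of beta-numbers of `λ`:
a strictly decreasing tuple of naturals below `h` ending in `0`, and every such tuple occurs. With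
`B` the sum of the beta-numbers, `(λ + ρ, w(μ + ρ))` is an integer pairing minus `B_λ B_μ / N`.
Hence `S` is a constant times a phase times `charDet`, an alternating sum of characters of `(ℤ/h)^N`
(`kacPetersonS_eq_charDet`).

For the inner product of rows `λ` and `ν` there are two cases. If `N` does not divide `B_λ - B_ν`,
the simple current permutes the columns and multiplies the inner product by a nontrivial root of
unity, so it vanishes (`sum_kacPetersonS_mul_conj_of_not_dvd`). If `B_λ - B_ν = N q`, the phases are
absorbed by translating the beta-numbers of `λ` by `-q`. The summand is then symmetric and
translation invariant in the column tuple and vanishes on repeated entries, so the sum over weights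
is the sum over all of `(ℤ/h)^N` divided by `h (N-1)!` (`sum_levelWeight_charDet_mul_conj`).
Character orthogonality evaluates that sum: it is `h^N N!` for equal weights and `0` otherwise,
since distinct weights cannot agree modulo `h` after such a translation and permutations
(`eq_zero_and_eq_of_betaNumber_sub_modEq`). -/

/-- The beta-numbers `∑_{i ≥ j} (l_i + 1)`: up to a common shift, the coordinates of the weight
with Dynkin labels `l` translated by the Weyl vector. -/
def betaNumber {n : ℕ} (l : Fin (n + 1) → ℕ) (j : Fin (n + 2)) : ℕ :=
  ∑ i : Fin (n + 1), if j ≤ i.castSucc then l i + 1 else 0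

/-! ### Beta-numbers and their rigidity -/

section BetaNumber

variable {n : ℕ} (l : Fin (n + 1) → ℕ)

theorem betaNumber_last : betaNumber l (Fin.last _) = 0 := by
  refine sum_eq_zero fun i _ => if_neg ?_
  exact not_le.2 (Fin.castSucc_lt_last i)

theorem betaNumber_zero : betaNumber l 0 = ∑ i, l i + (n + 1) := by
  simp [betaNumber, sum_add_distrib]

theorem betaNumber_castSucc (i : Fin (n + 1)) :
    betaNumber l i.castSucc = betaNumber l i.succ + (l i + 1) := by
  have h : ∀ x : Fin (n + 1), (if i.castSucc ≤ x.castSucc then l x + 1 else 0) =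
      (if i.succ ≤ x.castSucc then l x + 1 else 0) + if x = i then l i + 1 else 0 := by
    intro x
    rcases lt_trichotomy i x with h | h | h
    · have h1 : i.castSucc ≤ x.castSucc := h.le
      have h2 : i.succ ≤ x.castSucc := Fin.succ_le_castSucc_iff.2 h
      simp [h1, h2, h.ne']
    · subst h; simp
    · have h1 : ¬ i.castSucc ≤ x.castSucc := not_le.2 h
      have h2 : ¬ i.succ ≤ x.castSucc := by
        rw [Fin.succ_le_castSucc_iff]; exact h.not_gt
      simp [h1, h2, h.ne]
  simp only [betaNumber, h, sum_add_distrib]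
  simp

theorem betaNumber_strictAnti : StrictAnti (betaNumber l) := by
  rw [Fin.strictAnti_iff_succ_lt]
  intro i
  rw [betaNumber_castSucc]
  omega

theorem betaNumber_injective : Function.Injective (betaNumber l) :=
  (betaNumber_strictAnti l).injective

theorem betaNumber_le (j : Fin (n + 2)) : betaNumber l j ≤ ∑ i, l i + (n + 1) :=
  betaNumber_zero l ▸ (betaNumber_strictAnti l).antitone (Fin.zero_le j)

theorem eq_of_betaNumber_eq {l l' : Fin (n + 1) → ℕ} (h : betaNumber l = betaNumber l') :
    l = l' := by
  funext i
  have h1 := betaNumber_castSucc l i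
  have h2 := betaNumber_castSucc l' i
  rw [h] at h1
  omega

/-- The labels whose beta-numbers are a given strictly decreasing sequence ending in zero. -/
def labelsOf (c : Fin (n + 2) → ℕ) (i : Fin (n + 1)) : ℕ :=
  c i.castSucc - c i.succ - 1

theorem betaNumber_labelsOf {c : Fin (n + 2) → ℕ} (hc : StrictAnti c)
    (h0 : c (Fin.last _) = 0) : betaNumber (labelsOf c) = c := by
  funext j
  induction j using Fin.reverseInduction with
  | last => rw [betaNumber_last, h0]
  | cast i ih =>
    have h : c i.succ < c i.castSucc := hc (Fin.castSucc_lt_succ)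
    rw [betaNumber_castSucc, ih, labelsOf]
    omega

/-- A tuple has only one decreasing rearrangement, and distinct entries leave no freedom in the
permutation. -/
theorem eq_and_eq_of_betaNumber_comp_perm {l l' : Fin (n + 1) → ℕ}
    {σ τ : Equiv.Perm (Fin (n + 2))} (h : betaNumber l ∘ σ = betaNumber l' ∘ τ) :
    l = l' ∧ σ = τ := by
  have h1 : betaNumber l ∘ (σ * τ⁻¹ : Equiv.Perm _) = betaNumber l' := by
    funext j
    simpa using congrFun h (τ⁻¹ j)
  have h2 : betaNumber l ∘ (1 : Equiv.Perm (Fin (n + 2))) =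
      betaNumber l ∘ (σ * τ⁻¹ : Equiv.Perm (Fin (n + 2))) :=
    Tuple.unique_antitone (betaNumber_strictAnti l).antitone
      (h1 ▸ (betaNumber_strictAnti l').antitone)
  have h3 : betaNumber l = betaNumber l' := by rw [← h1, ← h2]; rfl
  refine ⟨eq_of_betaNumber_eq h3, ?_⟩
  ext1 j
  apply betaNumber_injective l
  simpa [h3] using congrFun h j

/-- Rigidity of the beta-numbers under translation modulo `h`. -/
theorem eq_zero_and_eq_of_betaNumber_sub_modEq {l l' : Fin (n + 1) → ℕ} {h : ℕ} {q : ℤ}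
    {σ τ : Equiv.Perm (Fin (n + 2))} (hl : ∀ j, betaNumber l j < h) (hl' : ∀ j, betaNumber l' j < h)
    (hq : ∑ j, (betaNumber l j : ℤ) - ∑ j, (betaNumber l' j : ℤ) = (n + 2) * q)
    (hmod : ∀ j, ((h : ℤ)) ∣ betaNumber l (σ j) - q - betaNumber l' (τ j)) :
    q = 0 ∧ l = l' ∧ σ = τ := by
  choose r hr using hmod
  have hσ : ∑ j, (betaNumber l (σ j) : ℤ) = ∑ j, (betaNumber l j : ℤ) :=
    Equiv.sum_comp σ fun j => (betaNumber l j : ℤ)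
  have hτ : ∑ j, (betaNumber l' (τ j) : ℤ) = ∑ j, (betaNumber l' j : ℤ) :=
    Equiv.sum_comp τ fun j => (betaNumber l' j : ℤ)
  have hpos : (0 : ℤ) < h := by exact_mod_cast (Nat.zero_le _).trans_lt (hl 0)
  have hsum : ∑ j, r j = 0 := by
    have : ∑ j, (h : ℤ) * r j = 0 := by
      simp only [← hr, sum_sub_distrib, hσ, hτ]
      simp
      linarith
    rw [← mul_sum] at this
    exact (mul_eq_zero.1 this).resolve_left hpos.ne'
  -- All beta-numbers lie in `[0, h)`, so the sign of `q` forces one weak sign on all `r j`; as they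
  -- sum to zero, they vanish.
  have hr0 : ∀ j, r j = 0 := by
    rcases le_total 0 q with hq0 | hq0
    · have hn : ∀ j ∈ univ, r j ≤ 0 := by
        intro j _
        have h1 := hr j
        have h2 := hl (σ j)
        by_contra hlt
        nlinarith
      intro j
      exact (sum_eq_zero_iff_of_nonpos hn).1 hsum j (mem_univ j)
    · have hn : ∀ j ∈ univ, 0 ≤ r j := by
        intro j _
        have h1 := hr j
        have h2 := hl' (τ j)
        by_contra hlt
        nlinarith
      intro j
      exact (sum_eq_zero_iff_of_nonneg hn).1 hsum j (mem_univ j)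
  simp only [hr0, mul_zero] at hr
  -- Both tuples are nonnegative and contain `0`; evaluating where each vanishes bounds `q` from
  -- both sides.
  have hq0 : q = 0 := by
    have h1 := hr (σ⁻¹ (Fin.last _))
    have h2 := hr (τ⁻¹ (Fin.last _))
    simp only [Equiv.Perm.inv_def, Equiv.apply_symm_apply, betaNumber_last] at h1 h2
    omega
  refine ⟨hq0, eq_and_eq_of_betaNumber_comp_perm ?_⟩
  funext j
  have := hr j
  simp only [Function.comp_apply]
  omega

end BetaNumber

/-! ### The simple current on weights -/

section SimpleCurrent

variable {n k : ℕ}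

/-- The simple current: the rotation of the affine Dynkin labels. -/
def rotateLabels (l : LevelWeight (n + 2) k) : LevelWeight (n + 2) k :=
  ⟨Fin.snoc (α := fun _ => ℕ) (Fin.tail (n := n) (α := fun _ => ℕ) l.1) (k - ∑ i, l.1 i), by
    have h1 := l.2
    have h2 := Fin.sum_univ_succ (n := n) l.1
    have h3 : ∀ f : Fin (n + 1) → ℕ, ∑ i : Fin (n + 2 - 1), f i = ∑ i : Fin (n + 1), f i :=
      fun _ => rfl
    rw [h3, Fin.sum_univ_castSucc]
    simp only [Fin.snoc_castSucc, Fin.snoc_last, Fin.tail]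
    rw [h3] at h1 ⊢
    omega⟩

theorem rotateLabels_injective : Function.Injective (rotateLabels (n := n) (k := k)) := by
  rintro ⟨l, hl⟩ ⟨l', hl'⟩ h
  change Fin (n + 1) → ℕ at l l'
  change ∑ i : Fin (n + 1), l i ≤ k at hl
  change ∑ i : Fin (n + 1), l' i ≤ k at hl'
  have h0 := congrArg Subtype.val h
  have h1 : ∀ x : Fin n, l x.succ = l' x.succ := by
    intro x
    have := congrFun h0 x.castSucc
    simpa [rotateLabels, Fin.tail] using this
  have h2 : k - ∑ i : Fin (n + 1), l i = k - ∑ i : Fin (n + 1), l' i := by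
    have := congrFun h0 (Fin.last n)
    simpa [rotateLabels] using this
  have h3 : l 0 = l' 0 := by
    have h4 : ∑ i : Fin (n + 1), l i = ∑ i : Fin (n + 1), l' i := by omega
    rw [Fin.sum_univ_succ, Fin.sum_univ_succ l'] at h4
    simp only [h1] at h4
    omega
  apply Subtype.ext
  funext x
  exact Fin.cases (motive := fun x => l x = l' x) h3 h1 x

/-- The entry that wraps around drops by `k + N`. The identity is kept over `ℤ` because the phase
needs the exact total, not only residues. -/
theorem betaNumber_rotateLabels (l : LevelWeight (n + 2) k) (j : Fin (n + 2)) :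
    (betaNumber (rotateLabels l).1 j : ℤ) =
      betaNumber (n := n) l.1 (finRotate _ j) + ((k : ℤ) + n + 2 - betaNumber (n := n) l.1 0)
        - if j = Fin.last _ then ((k : ℤ) + n + 2) else 0 := by
  induction j using Fin.lastCases with
  | last => rw [betaNumber_last, finRotate_last]; simp
  | cast i =>
    obtain ⟨l, hl⟩ := l
    change Fin (n + 1) → ℕ at l
    change ∑ i : Fin (n + 1), l i ≤ k at hl
    have hrot : finRotate (n + 2) i.castSucc = i.succ := by
      ext; simp
    rw [hrot, if_neg (Fin.castSucc_lt_last i).ne, betaNumber_zero]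
    have h1 : betaNumber (n := n) (rotateLabels (n := n) ⟨l, hl⟩).1 i.castSucc =
        betaNumber l i.succ + (k - ∑ i, l i + 1) := by
      rw [betaNumber, betaNumber, Fin.sum_univ_castSucc, Fin.sum_univ_succ]
      have : ¬ i.succ ≤ Fin.castSucc (0 : Fin (n + 1)) := by
        simp
      simp only [this, if_false, zero_add]
      congr 1
      · refine sum_congr rfl fun x _ => ?_
        simp [rotateLabels, Fin.tail]
      · simp [rotateLabels, Fin.le_last]
    rw [h1]
    push_cast [hl]
    ring

end SimpleCurrent

/-! ### Alternating character sums over `ℤ/h` -/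

theorem map_sum_stdAddChar {ι : Type*} [Fintype ι] {h : ℕ} [NeZero h]
    (f : ι → ZMod h) :
    (ZMod.stdAddChar (∑ j, f j) : ℂ) = ∏ j, ZMod.stdAddChar (f j) := by
  have h1 := map_prod (ZMod.stdAddChar (N := h)).toMonoidHom
    (fun j => Multiplicative.ofAdd (f j)) univ
  rwa [← ofAdd_sum] at h1

section CharacterDet

variable {ι : Type*} [Fintype ι] [DecidableEq ι] {h : ℕ} [NeZero h]

/-- The alternating sum `∑_w det(w) ψ(-(x, w c))` of additive characters of `ℤ/h`. -/
noncomputable def charDet (x c : ι → ZMod h) : ℂ :=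
  (Matrix.of fun i j => ZMod.stdAddChar (-(x i * c j))).det

theorem charDet_eq_sum (x c : ι → ZMod h) :
    charDet x c = ∑ w : Equiv.Perm ι, ((Equiv.Perm.sign w : ℤ) : ℂ) *
      ZMod.stdAddChar (-∑ j, x (w j) * c j) := by
  rw [charDet, Matrix.det_apply']
  refine sum_congr rfl fun w _ => ?_
  rw [← sum_neg_distrib, map_sum_stdAddChar]
  rfl

theorem charDet_comp_perm (x c : ι → ZMod h) (w : Equiv.Perm ι) :
    charDet x (c ∘ w) = ((Equiv.Perm.sign w : ℤ) : ℂ) * charDet x c :=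
  Matrix.det_permute' w (Matrix.of fun i j => ZMod.stdAddChar (-(x i * c j)))

theorem charDet_eq_zero {c : ι → ZMod h} (hc : ¬ Function.Injective c) (x : ι → ZMod h) :
    charDet x c = 0 := by
  simp only [Function.Injective, not_forall] at hc
  obtain ⟨i, j, hij, hne⟩ := hc
  exact Matrix.det_zero_of_column_eq hne fun a => by simp [hij]

theorem charDet_add_const (x c : ι → ZMod h) (t : ZMod h) :
    charDet x (fun j => c j + t) = ZMod.stdAddChar (-(t * ∑ j, x j)) * charDet x c := by
  rw [charDet_eq_sum, charDet_eq_sum, mul_sum]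
  refine sum_congr rfl fun w _ => ?_
  rw [mul_left_comm, ← AddChar.map_add_eq_mul, ← Equiv.sum_comp w x, ← neg_add, mul_sum,
    ← sum_add_distrib]
  congr 3
  exact sum_congr rfl fun j _ => by ring

/-- This factor is what absorbs the phases of `S` when `N` divides the difference of the beta-sums.
-/
theorem charDet_sub_const (x c : ι → ZMod h) (q : ZMod h) :
    charDet (fun j => x j - q) c = ZMod.stdAddChar (q * ∑ j, c j) * charDet x c := by
  rw [charDet_eq_sum, charDet_eq_sum, mul_sum]
  refine sum_congr rfl fun w _ => ?_
  rw [mul_left_comm, ← AddChar.map_add_eq_mul, mul_sum, ← sub_eq_add_neg, ← sum_sub_distrib,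
    ← sum_neg_distrib]
  congr 2
  exact sum_congr rfl fun j _ => by ring

theorem conj_stdAddChar (a : ZMod h) :
    (starRingEnd ℂ) (ZMod.stdAddChar a) = ZMod.stdAddChar (-a) := by
  rw [AddChar.starComp_apply (by simp [ZMod.ringChar_zmod_n, NeZero.pos]), AddChar.inv_apply]

theorem stdAddChar_mul_conj (a : ZMod h) :
    (ZMod.stdAddChar a : ℂ) * (starRingEnd ℂ) (ZMod.stdAddChar a) = 1 := by
  rw [conj_stdAddChar, ← AddChar.map_add_eq_mul, add_neg_cancel, AddChar.map_zero_eq_one]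

theorem sum_stdAddChar_neg_sum_mul (z : ι → ZMod h) :
    ∑ c : ι → ZMod h, (ZMod.stdAddChar (-∑ j, z j * c j) : ℂ) =
      if z = 0 then (h : ℂ) ^ Fintype.card ι else 0 := by
  have h1 : ∀ c : ι → ZMod h, (ZMod.stdAddChar (-∑ j, z j * c j) : ℂ) =
      ∏ j, ZMod.stdAddChar (c j * -z j) := by
    intro c
    rw [← sum_neg_distrib, map_sum_stdAddChar]
    exact prod_congr rfl fun j _ => by congr 1; ring
  simp only [h1]
  rw [← Fintype.prod_sum (fun j (y : ZMod h) => (ZMod.stdAddChar (y * -z j) : ℂ))]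
  simp only [AddChar.sum_mulShift _ (ZMod.isPrimitive_stdAddChar h)]
  split_ifs with hz
  · subst hz; simp
  · obtain ⟨j, hj⟩ := Function.ne_iff.1 hz
    exact prod_eq_zero (mem_univ j) (by simp at hj; simp [hj])

/-- Orthogonality of alternating character sums over all of `(ℤ/h)^ι`. -/
theorem sum_charDet_mul_conj (x y : ι → ZMod h) :
    ∑ c, charDet x c * (starRingEnd ℂ) (charDet y c) =
      ∑ σ : Equiv.Perm ι, ∑ τ : Equiv.Perm ι, ((Equiv.Perm.sign σ : ℤ) : ℂ) *
        ((Equiv.Perm.sign τ : ℤ) : ℂ) *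
          if x ∘ σ = y ∘ τ then (h : ℂ) ^ Fintype.card ι else 0 := by
  have h1 : ∀ c : ι → ZMod h, charDet x c * (starRingEnd ℂ) (charDet y c) =
      ∑ σ : Equiv.Perm ι, ∑ τ : Equiv.Perm ι, ((Equiv.Perm.sign σ : ℤ) : ℂ) *
        ((Equiv.Perm.sign τ : ℤ) : ℂ) *
          ZMod.stdAddChar (-∑ j, (x (σ j) - y (τ j)) * c j) := by
    intro c
    rw [charDet_eq_sum, charDet_eq_sum, map_sum, sum_mul_sum]
    refine sum_congr rfl fun σ _ => sum_congr rfl fun τ _ => ?_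
    rw [map_mul, conj_stdAddChar, map_intCast, mul_mul_mul_comm, ← AddChar.map_add_eq_mul]
    simp only [sub_mul, sum_sub_distrib]
    congr 2
    ring
  simp only [h1]
  rw [sum_comm]
  refine sum_congr rfl fun σ _ => ?_
  rw [sum_comm]
  refine sum_congr rfl fun τ _ => ?_
  rw [← mul_sum, sum_stdAddChar_neg_sum_mul fun j => x (σ j) - y (τ j)]
  congr 2
  simp [funext_iff, sub_eq_zero]

theorem sum_charDet_mul_conj_eq_zero {x y : ι → ZMod h}
    (hxy : ∀ σ τ : Equiv.Perm ι, x ∘ σ ≠ y ∘ τ) :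
    ∑ c, charDet x c * (starRingEnd ℂ) (charDet y c) = 0 := by
  simp [sum_charDet_mul_conj, hxy]

theorem sum_charDet_mul_conj_self {x : ι → ZMod h} (hx : Function.Injective x) :
    ∑ c, charDet x c * (starRingEnd ℂ) (charDet x c) =
      (h : ℂ) ^ Fintype.card ι * (Fintype.card ι).factorial := by
  have h1 : ∀ σ τ : Equiv.Perm ι, x ∘ σ = x ∘ τ ↔ σ = τ := by
    intro σ τ
    rw [hx.comp_left.eq_iff, DFunLike.coe_fn_eq]
  have h2 : ∀ σ : Equiv.Perm ι, ((Equiv.Perm.sign σ : ℤ) : ℂ) * ((Equiv.Perm.sign σ : ℤ) : ℂ) = 1 := by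
    intro σ
    rw [← Int.cast_mul, ← Units.val_mul, Int.units_mul_self]
    simp
  simp only [sum_charDet_mul_conj, h1, mul_ite, mul_zero, sum_ite_eq, mem_univ, if_true, h2]
  simp [Fintype.card_perm, mul_comm]

end CharacterDet

/-! ### From all residue tuples to integrable weights -/

section Tuples

variable {n k : ℕ}

/-- Each translation orbit has `h` elements, exactly one of which ends in zero. -/
theorem sum_tuples_eq_of_translation_invariant {h : ℕ} [NeZero h] (g : (Fin (n + 2) → ZMod h) → ℂ)
    (hg : ∀ c t, g (fun j => c j + t) = g c) :
    ∑ c, g c = h * ∑ c : Fin (n + 1) → ZMod h, g (Fin.snoc (α := fun _ => ZMod h) c 0) := by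
  rw [← Equiv.sum_comp (Fin.snocEquiv fun _ : Fin (n + 2) => ZMod h), Fintype.sum_prod_type]
  have h1 : ∀ t : ZMod h, ∑ c : Fin (n + 1) → ZMod h,
      g (Fin.snocEquiv (fun _ : Fin (n + 2) => ZMod h) (t, c)) =
      ∑ c : Fin (n + 1) → ZMod h, g (Fin.snoc (α := fun _ => ZMod h) c 0) := by
    intro t
    rw [← Equiv.sum_comp (Equiv.addRight (fun _ : Fin (n + 1) => t))]
    refine sum_congr rfl fun c _ => ?_
    rw [← hg (Fin.snoc (α := fun _ => ZMod h) c 0) t]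
    congr 1
    funext j
    induction j using Fin.lastCases with
    | last => simp [Fin.snocEquiv]
    | cast i => simp [Fin.snocEquiv]
  rw [sum_congr rfl fun t _ => h1 t]
  simp

theorem betaNumber_lt (l : LevelWeight (n + 2) k) (j : Fin (n + 2)) :
    betaNumber (n := n) l.1 j < k + n + 2 := by
  have h1 := betaNumber_le (n := n) l.1 j
  have h2 : ∑ i : Fin (n + 1), l.1 i ≤ k := l.2
  omega

/-- The beta-numbers of a weight modulo `k + N`. -/
def betaResidue (l : LevelWeight (n + 2) k) (j : Fin (n + 2)) : ZMod (k + n + 2) :=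
  (betaNumber (n := n) l.1 j : ℕ)

theorem val_betaResidue (l : LevelWeight (n + 2) k) (j : Fin (n + 2)) :
    (betaResidue l j).val = betaNumber (n := n) l.1 j :=
  ZMod.val_cast_of_lt (betaNumber_lt l j)

theorem betaResidue_injective (l : LevelWeight (n + 2) k) : Function.Injective (betaResidue l) := by
  intro i j hij
  apply betaNumber_injective (n := n) l.1
  rw [← val_betaResidue, ← val_betaResidue, hij]

/-- The permutation of `n + 2` letters extending one of the first `n + 1`. -/
def extendPerm (σ : Equiv.Perm (Fin (n + 1))) : Equiv.Perm (Fin (n + 2)) :=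
  σ.viaFintypeEmbedding Fin.castSuccEmb

theorem extendPerm_castSucc (σ : Equiv.Perm (Fin (n + 1))) (i : Fin (n + 1)) :
    extendPerm σ i.castSucc = (σ i).castSucc :=
  Equiv.Perm.viaFintypeEmbedding_apply_image σ Fin.castSuccEmb i

theorem extendPerm_last (σ : Equiv.Perm (Fin (n + 1))) :
    extendPerm σ (Fin.last _) = Fin.last _ := by
  refine Equiv.Perm.viaFintypeEmbedding_apply_notMem_range σ Fin.castSuccEmb ?_
  rintro ⟨i, hi⟩
  exact (Fin.castSucc_lt_last i).ne hi

theorem extendPerm_injective : Function.Injective (extendPerm (n := n)) := by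
  intro σ τ h
  ext1 i
  have := congrArg (fun w => w i.castSucc) h
  simpa [extendPerm_castSucc] using this

/-- Sort all entries but the last decreasingly; the final zero is already the minimum. The gaps
minus one are the labels, and the bound on the top entry is the level condition. -/
theorem exists_betaNumber_comp_extendPerm {c : Fin (n + 2) → ℕ} (hc : Function.Injective c)
    (h0 : c (Fin.last _) = 0) (hlt : ∀ j, c j < k + n + 2) :
    ∃ (σ : Equiv.Perm (Fin (n + 1))) (l : LevelWeight (n + 2) k),
      betaNumber (n := n) l.1 ∘ extendPerm σ = c := by
  let f : Fin (n + 1) → ℕᵒᵈ := fun i => OrderDual.toDual (c i.castSucc)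
  let σ := Tuple.sort f
  have hmono : Antitone fun i => c (σ i).castSucc := Tuple.monotone_sort f
  let d : Fin (n + 2) → ℕ := c ∘ extendPerm σ
  have hdinj : Function.Injective d := hc.comp (extendPerm σ).injective
  have hdlast : d (Fin.last _) = 0 := by simp [d, extendPerm_last, h0]
  have hd : StrictAnti d := by
    rw [Fin.strictAnti_iff_succ_lt]
    intro i
    refine lt_of_le_of_ne ?_ (hdinj.ne (Fin.castSucc_lt_succ).ne')
    induction i using Fin.lastCases with
    | last => rw [Fin.succ_last, hdlast]; exact Nat.zero_le _
    | cast i =>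
      have := hmono (Fin.castSucc_lt_succ (i := i)).le
      simpa [d, Fin.succ_castSucc, extendPerm_castSucc, -Fin.castSucc_succ] using this
  have hb := betaNumber_labelsOf hd hdlast
  have hk : ∑ i, labelsOf d i ≤ k := by
    have h1 := betaNumber_zero (labelsOf d)
    rw [hb] at h1
    have h2 : d 0 < k + n + 2 := hlt _
    omega
  refine ⟨σ⁻¹, ⟨labelsOf d, hk⟩, ?_⟩
  change betaNumber (labelsOf d) ∘ _ = c
  rw [hb]
  funext j
  induction j using Fin.lastCases with
  | last => simp [d, extendPerm_last]
  | cast i => simp [d, extendPerm_castSucc]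

/-- Sums of symmetric functions over tuples ending in zero, in terms of integrable weights. -/
theorem sum_tuples_eq_sum_levelWeight (g : (Fin (n + 2) → ZMod (k + n + 2)) → ℂ)
    (hperm : ∀ c (w : Equiv.Perm (Fin (n + 2))), g (c ∘ w) = g c)
    (hzero : ∀ c, ¬ Function.Injective c → g c = 0) :
    ∑ c : Fin (n + 1) → ZMod (k + n + 2), g (Fin.snoc (α := fun _ => ZMod (k + n + 2)) c 0) =
      (n + 1).factorial * ∑ l : LevelWeight (n + 2) k, g (betaResidue l) := by
  have h1 : ∀ p : Equiv.Perm (Fin (n + 1)) × LevelWeight (n + 2) k,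
      Fin.snoc (α := fun _ => ZMod (k + n + 2))
        (fun i => betaResidue p.2 (extendPerm p.1 i.castSucc)) 0 =
      betaResidue p.2 ∘ extendPerm p.1 := by
    intro p
    funext j
    induction j using Fin.lastCases with
    | last => simp [extendPerm_last, betaResidue, betaNumber_last]
    | cast i => simp
  have h2 : ∑ p : Equiv.Perm (Fin (n + 1)) × LevelWeight (n + 2) k, g (betaResidue p.2) =
      ∑ c : Fin (n + 1) → ZMod (k + n + 2), g (Fin.snoc (α := fun _ => ZMod (k + n + 2)) c 0) := by
    refine sum_of_injOn (fun p i => betaResidue p.2 (extendPerm p.1 i.castSucc)) ?_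
      (fun _ _ => mem_coe.2 (mem_univ _)) ?_ ?_
    · rintro ⟨σ, l⟩ - ⟨τ, l'⟩ - h
      have h3 : betaResidue l ∘ extendPerm σ = betaResidue l' ∘ extendPerm τ := by
        rw [← h1 (σ, l), ← h1 (τ, l')]
        exact congrArg (fun c => Fin.snoc (α := fun _ => ZMod (k + n + 2)) c 0) h
      have h4 : betaNumber (n := n) l.1 ∘ extendPerm σ =
          betaNumber (n := n) l'.1 ∘ extendPerm τ := by
        funext j
        simpa [val_betaResidue] using congrArg ZMod.val (congrFun h3 j)
      obtain ⟨h5, h6⟩ := eq_and_eq_of_betaNumber_comp_perm h4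
      exact Prod.ext (extendPerm_injective h6) (Subtype.ext h5)
    · intro c _ hc
      by_contra hne
      apply hc
      have hinj : Function.Injective (Fin.snoc (α := fun _ => ZMod (k + n + 2)) c 0) := by
        by_contra hi
        exact hne (hzero _ hi)
      obtain ⟨σ, l, hl⟩ := exists_betaNumber_comp_extendPerm (k := k)
        (c := fun j => (Fin.snoc (α := fun _ => ZMod (k + n + 2)) c 0 j : ZMod (k + n + 2)).val)
        ((ZMod.val_injective _).comp hinj) (by simp) (fun j => ZMod.val_lt _)
      refine ⟨(σ, l), by simp, ?_⟩
      funext i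
      apply ZMod.val_injective
      have := congrFun hl i.castSucc
      simpa [val_betaResidue] using this
    · intro p _
      rw [h1, hperm]
  rw [← h2, Fintype.sum_prod_type]
  simp [Fintype.card_perm]

/-- Equality of the two sums makes the phases from translating the column tuple cancel. -/
theorem sum_levelWeight_charDet_mul_conj {x y : Fin (n + 2) → ZMod (k + n + 2)}
    (hxy : ∑ j, x j = ∑ j, y j) :
    ((k : ℂ) + n + 2) * (n + 1).factorial * ∑ l : LevelWeight (n + 2) k,
        charDet x (betaResidue l) * (starRingEnd ℂ) (charDet y (betaResidue l)) =
      ∑ c, charDet x c * (starRingEnd ℂ) (charDet y c) := by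
  rw [sum_tuples_eq_of_translation_invariant
    (fun c => charDet x c * (starRingEnd ℂ) (charDet y c)),
    sum_tuples_eq_sum_levelWeight (fun c => charDet x c * (starRingEnd ℂ) (charDet y c))]
  · push_cast; ring
  · intro c w
    rw [charDet_comp_perm, charDet_comp_perm, map_mul, mul_mul_mul_comm, map_intCast,
      ← Int.cast_mul, ← Units.val_mul, Int.units_mul_self]
    simp
  · intro c hc
    rw [charDet_eq_zero hc, zero_mul]
  · intro c t
    rw [charDet_add_const, charDet_add_const, map_mul, mul_mul_mul_comm, hxy,
      stdAddChar_mul_conj, one_mul]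

end Tuples

/-! ### Shifted weights in beta coordinates -/

section Weights

variable {n k : ℕ}

theorem sum_root (N : ℕ) (p : Fin N × Fin N) : ∑ j, root N p j = 0 := by
  simp [root, sum_sub_distrib]

theorem sum_weylVector (N : ℕ) : ∑ j, weylVector N j = 0 := by
  simp only [weylVector, Pi.smul_apply, Finset.sum_apply, ← smul_sum]
  rw [sum_comm]
  simp [sum_root]

theorem sum_fundamentalWeight (i : Fin (n + 1)) : ∑ j, fundamentalWeight (n + 2) i j = 0 := by
  have h1 : ∑ j : Fin (n + 2), (if (j : ℕ) ≤ (i : ℕ) then (1 : ℝ) else 0) = (i : ℝ) + 1 := by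
    have h2 : (univ.filter fun j : Fin (n + 2) => (j : ℕ) ≤ (i : ℕ)) = Finset.Iic i.castSucc := by
      ext j; simp [Fin.le_def]
    rw [sum_boole, h2, Fin.card_Iic]
    simp
  simp only [fundamentalWeight, sum_sub_distrib, h1]
  simp
  field_simp
  ring

theorem sum_weightVector (l : LevelWeight (n + 2) k) : ∑ j, weightVector l j = 0 := by
  simp only [weightVector, Finset.sum_apply, Pi.smul_apply]
  rw [sum_comm]
  refine sum_eq_zero fun i _ => ?_
  rw [← smul_sum, sum_fundamentalWeight (n := n) i, smul_zero]

theorem weylVector_apply (N : ℕ) (j : Fin N) : weylVector N j = ((N : ℝ) - 1) / 2 - j := by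
  have h1 : ∑ p ∈ posRootIndices N, (Pi.single p.1 1 : Fin N → ℝ) j = (N : ℝ) - 1 - j := by
    rw [posRootIndices, sum_filter, Fintype.sum_prod_type]
    simp only [Pi.single_apply]
    rw [sum_eq_single j (fun a _ ha => sum_eq_zero fun b _ => by simp [ha.symm]) (by simp)]
    have h2 : (univ.filter fun b : Fin N => j < b) = Finset.Ioi j := by ext; simp
    simp only [if_true]
    have h3 : N - 1 - (j : ℕ) + (j + 1) = N := by omega
    have h4 : ((N - 1 - (j : ℕ) : ℕ) : ℝ) + (j + 1) = N := by exact_mod_cast h3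
    rw [sum_boole, h2, Fin.card_Ioi]
    linarith
  have h3 : ∑ p ∈ posRootIndices N, (Pi.single p.2 1 : Fin N → ℝ) j = (j : ℝ) := by
    rw [posRootIndices, sum_filter, Fintype.sum_prod_type, sum_comm]
    simp only [Pi.single_apply]
    rw [sum_eq_single j (fun a _ ha => sum_eq_zero fun b _ => by simp [ha.symm]) (by simp)]
    have h2 : (univ.filter fun b : Fin N => b < j) = Finset.Iio j := by ext; simp
    simp only [if_true]
    rw [sum_boole, h2, Fin.card_Iio]
  simp only [weylVector, root, Pi.smul_apply, Finset.sum_apply, Pi.sub_apply, sum_sub_distrib, h1,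
    h3, smul_eq_mul]
  ring

/-- The total of the beta-numbers. -/
def betaSum (l : LevelWeight (n + 2) k) : ℕ :=
  ∑ j, betaNumber (n := n) l.1 j

theorem exists_weightVector_add_weylVector_eq (l : LevelWeight (n + 2) k) :
    ∃ s : ℝ, ∀ j, (weightVector l + weylVector (n + 2)) j = betaNumber (n := n) l.1 j - s := by
  obtain ⟨l, hl⟩ := l
  change Fin (n + 1) → ℕ at l
  refine ⟨∑ i : Fin (n + 1), (l i : ℝ) * (((i : ℝ) + 1) / ((n : ℝ) + 2)) + ((n : ℝ) + 1) / 2,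
    fun j => ?_⟩
  have h1 : ∑ i : Fin (n + 1), (if j ≤ i.castSucc then (1 : ℝ) else 0) = (n : ℝ) + 1 - j := by
    have h2 : (univ.filter fun i : Fin (n + 1) => j ≤ i.castSucc).card = n + 1 - (j : ℕ) := by
      induction j using Fin.lastCases with
      | last => simp [Fin.le_def]; intro i; omega
      | cast j =>
        have : (univ.filter fun i : Fin (n + 1) => j.castSucc ≤ i.castSucc) = Finset.Ici j := by
          ext; simp
        rw [this, Fin.card_Ici]
        simp
    rw [sum_boole, h2, Nat.cast_sub (by omega)]
    simp
  have h3 : ((betaNumber l j : ℕ) : ℝ) =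
      ∑ i : Fin (n + 1), (l i : ℝ) * (if j ≤ i.castSucc then 1 else 0) + ((n : ℝ) + 1 - j) := by
    rw [← h1, ← sum_add_distrib, betaNumber, Nat.cast_sum]
    refine sum_congr rfl fun i _ => ?_
    split_ifs <;> simp
  have h4 : weightVector (N := n + 2) ⟨l, hl⟩ j =
      ∑ i : Fin (n + 1), ((l i : ℝ) * (if j ≤ i.castSucc then 1 else 0) -
        (l i : ℝ) * (((i : ℝ) + 1) / ((n : ℝ) + 2))) := by
    rw [weightVector, Finset.sum_apply]
    refine sum_congr rfl fun i _ => ?_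
    simp only [fundamentalWeight, Pi.smul_apply, smul_eq_mul, mul_sub, Fin.le_def]
    push_cast
    rfl
  rw [Pi.add_apply, weylVector_apply, h4, sum_sub_distrib]
  change _ = ((betaNumber l j : ℕ) : ℝ) - _
  rw [h3]
  push_cast
  ring

theorem weightVector_add_weylVector (l : LevelWeight (n + 2) k) (j : Fin (n + 2)) :
    (weightVector l + weylVector (n + 2)) j =
      betaNumber (n := n) l.1 j - (betaSum l : ℝ) / (n + 2) := by
  obtain ⟨s, hs⟩ := exists_weightVector_add_weylVector_eq l
  have h1 : ∑ j, (weightVector l + weylVector (n + 2)) j = 0 := by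
    simp [sum_add_distrib, sum_weightVector, sum_weylVector]
  -- The coordinates of a weight sum to zero, which determines the shift.
  have h2 : s = (betaSum l : ℝ) / (n + 2) := by
    simp only [hs, sum_sub_distrib] at h1
    simp at h1
    rw [betaSum, eq_div_iff (by positivity)]
    push_cast
    linarith
  rw [hs, h2]

theorem dotProduct_weylAct (l m : LevelWeight (n + 2) k) (w : Equiv.Perm (Fin (n + 2))) :
    (weightVector l + weylVector (n + 2)) ⬝ᵥ weylAct w (weightVector m + weylVector (n + 2)) =
      ((∑ j, betaNumber (n := n) l.1 (w j) * betaNumber (n := n) m.1 j : ℕ) : ℝ) -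
        (betaSum l : ℝ) * betaSum m / (n + 2) := by
  have h0 : ((n : ℝ) + 2) ≠ 0 := by positivity
  rw [dotProduct, ← Equiv.sum_comp w]
  simp only [weylAct, Equiv.Perm.inv_def, Equiv.symm_apply_apply, weightVector_add_weylVector]
  have h1 : ∑ j, (betaNumber (n := n) l.1 (w j) : ℝ) = betaSum l := by
    rw [Equiv.sum_comp w fun j => (betaNumber (n := n) l.1 j : ℝ), betaSum, Nat.cast_sum]
  have h2 : ∑ j, (betaNumber (n := n) m.1 j : ℝ) = betaSum m := by
    rw [betaSum, Nat.cast_sum]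
  simp only [sub_mul, mul_sub, sum_sub_distrib, ← sum_mul, ← mul_sum, h1, h2]
  simp
  field_simp
  ring

/-! ### The `S`-matrix as a phase times `charDet` -/

/-- `exp(2πi x)`. -/
noncomputable def expTurn (x : ℝ) : ℂ :=
  Complex.exp (2 * (Real.pi : ℂ) * Complex.I * (x : ℂ))

theorem expTurn_add (x y : ℝ) : expTurn (x + y) = expTurn x * expTurn y := by
  rw [expTurn, expTurn, expTurn, ← Complex.exp_add]
  push_cast
  ring_nf

theorem conj_expTurn (x : ℝ) : (starRingEnd ℂ) (expTurn x) = expTurn (-x) := by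
  rw [expTurn, expTurn, ← Complex.exp_conj]
  simp [Complex.conj_ofNat]

theorem expTurn_eq_one_iff (x : ℝ) : expTurn x = 1 ↔ ∃ q : ℤ, x = q := by
  rw [expTurn, Complex.exp_eq_one_iff]
  refine exists_congr fun q => ?_
  rw [mul_comm, mul_left_inj' Complex.two_pi_I_ne_zero]
  norm_cast

theorem stdAddChar_intCast {h : ℕ} [NeZero h] (j : ℤ) :
    (ZMod.stdAddChar (j : ZMod h) : ℂ) = expTurn (j / h) := by
  rw [ZMod.stdAddChar_coe, expTurn]
  push_cast
  ring_nf

/-- The integer part of the inner product gives a character of `ℤ/(k+N)`; the part with denominator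
`N` does not depend on `w` and factors out. -/
theorem kacPetersonS_eq_charDet (l m : LevelWeight (n + 2) k) :
    kacPetersonS (n + 2) k l m = kacPetersonConst (n + 2) k *
      (expTurn ((betaSum l : ℝ) * betaSum m / ((n + 2) * (k + n + 2))) *
        charDet (betaResidue l) (betaResidue m)) := by
  rw [kacPetersonS, charDet_eq_sum, mul_sum _ _ (expTurn _)]
  refine congrArg (kacPetersonConst (n + 2) k * ·) (sum_congr rfl fun w _ => ?_)
  have h1 : -∑ j, betaResidue l (w j) * betaResidue m j =
      ((-(∑ j, betaNumber (n := n) l.1 (w j) * betaNumber (n := n) m.1 j : ℕ) : ℤ) :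
        ZMod (k + n + 2)) := by
    simp [betaResidue]
  rw [mul_left_comm, h1, stdAddChar_intCast, ← expTurn_add, dotProduct_weylAct, expTurn]
  congr 2
  have h2 : (k : ℂ) + n + 2 ≠ 0 := by
    exact_mod_cast (by omega : k + n + 2 ≠ 0)
  have h3 : (n : ℂ) + 2 ≠ 0 := by
    exact_mod_cast (by omega : n + 2 ≠ 0)
  push_cast
  rw [← add_assoc]
  field_simp
  ring

theorem kacPetersonConst_mul_conj :
    kacPetersonConst (n + 2) k * (starRingEnd ℂ) (kacPetersonConst (n + 2) k) =
      (((n : ℂ) + 2) * ((k : ℂ) + n + 2) ^ (n + 1))⁻¹ := by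
  rw [Complex.mul_conj, kacPetersonConst, map_div₀, map_pow, Complex.normSq_I, one_pow,
    Complex.normSq_ofReal, one_div]
  have h1 : ∀ a b : ℝ, a * b * (a * b) = a ^ 2 * b ^ 2 := fun a b => by ring
  rw [h1, ← pow_mul, mul_comm (n + 2 - 1) 2, pow_mul, Real.sq_sqrt (by positivity),
    Real.sq_sqrt (by positivity)]
  push_cast
  rw [← add_assoc]

theorem betaResidue_rotateLabels (m : LevelWeight (n + 2) k) :
    betaResidue (rotateLabels m) =
      fun j => (betaResidue m ∘ finRotate (n + 2)) j + -betaResidue m 0 := by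
  funext j
  have h1 := congrArg (Int.cast : ℤ → ZMod (k + n + 2)) (betaNumber_rotateLabels m j)
  have h2 : (k : ZMod (k + n + 2)) + n + 2 = 0 := by
    exact_mod_cast ZMod.natCast_self (k + n + 2)
  have h3 : ((if j = Fin.last _ then ((k : ℤ) + n + 2) else 0 : ℤ) : ZMod (k + n + 2)) = 0 := by
    split_ifs
    · push_cast; exact h2
    · simp
  rw [Int.cast_sub, h3] at h1
  push_cast at h1
  rw [h2] at h1
  simp only [betaResidue, h1, Function.comp_apply]
  ring

theorem betaSum_rotateLabels (m : LevelWeight (n + 2) k) :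
    (betaSum (rotateLabels m) : ℝ) = betaSum m +
      (n + 2) * ((k : ℝ) + n + 2 - betaNumber (n := n) m.1 0) - (k + n + 2) := by
  have h1 : ((betaSum (rotateLabels m) : ℕ) : ℤ) = betaSum m +
      (n + 2) * ((k : ℤ) + n + 2 - betaNumber (n := n) m.1 0) - (k + n + 2) := by
    rw [betaSum, Nat.cast_sum, sum_congr rfl fun j _ => betaNumber_rotateLabels m j,
      sum_sub_distrib, sum_add_distrib,
      Equiv.sum_comp (finRotate (n + 2)) fun j => (betaNumber (n := n) m.1 j : ℤ), betaSum]
    simp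
    ring
  exact_mod_cast h1

/-- The action of the simple current on the columns of the `S`-matrix. -/
theorem kacPetersonS_rotateLabels (l m : LevelWeight (n + 2) k) :
    kacPetersonS (n + 2) k l (rotateLabels m) =
      ((Equiv.Perm.sign (finRotate (n + 2)) : ℤ) : ℂ) * expTurn (-((betaSum l : ℝ) / (n + 2))) *
        kacPetersonS (n + 2) k l m := by
  have h1 : -(-betaResidue m 0 * ∑ j, betaResidue l j) =
      ((betaNumber (n := n) m.1 0 * betaSum l : ℤ) : ZMod (k + n + 2)) := by
    simp [betaResidue, betaSum]
  have h2 : expTurn ((betaSum l : ℝ) * betaSum (rotateLabels m) / ((n + 2) * (k + n + 2))) *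
      expTurn (((betaNumber (n := n) m.1 0 * betaSum l : ℤ) : ℝ) / ((k + n + 2 : ℕ) : ℝ)) =
      expTurn (-((betaSum l : ℝ) / (n + 2))) *
      expTurn ((betaSum l : ℝ) * betaSum m / ((n + 2) * (k + n + 2))) := by
    -- The two total exponents differ by exactly the integer `betaSum l`.
    have h3 : expTurn (betaSum l : ℝ) = 1 := (expTurn_eq_one_iff _).2 ⟨betaSum l, by simp⟩
    have h4 : (k : ℝ) + n + 2 ≠ 0 := by positivity
    have h5 : (n : ℝ) + 2 ≠ 0 := by positivity
    rw [← mul_one (_ * expTurn ((betaSum l : ℝ) * betaSum m / _)), ← h3, ← expTurn_add,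
      ← expTurn_add, ← expTurn_add, betaSum_rotateLabels]
    congr 1
    push_cast
    field_simp
    ring
  rw [kacPetersonS_eq_charDet, kacPetersonS_eq_charDet, betaResidue_rotateLabels,
    charDet_add_const, charDet_comp_perm, h1, stdAddChar_intCast]
  linear_combination kacPetersonConst (n + 2) k *
    ((Equiv.Perm.sign (finRotate (n + 2)) : ℤ) : ℂ) *
    charDet (betaResidue l) (betaResidue m) * h2

/-! ### Orthogonality of the rows -/

theorem sum_kacPetersonS_mul_conj_of_not_dvd {l l' : LevelWeight (n + 2) k}
    (h : ¬ ((n : ℤ) + 2) ∣ betaSum l - betaSum l') :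
    ∑ m, kacPetersonS (n + 2) k l m * (starRingEnd ℂ) (kacPetersonS (n + 2) k l' m) = 0 := by
  have hbij : Function.Bijective (rotateLabels (n := n) (k := k)) :=
    Finite.injective_iff_bijective.1 rotateLabels_injective
  have h1 : ∀ m, kacPetersonS (n + 2) k l (rotateLabels m) *
      (starRingEnd ℂ) (kacPetersonS (n + 2) k l' (rotateLabels m)) =
      expTurn (-((betaSum l : ℝ) / (n + 2)) + (betaSum l' : ℝ) / (n + 2)) *
      (kacPetersonS (n + 2) k l m * (starRingEnd ℂ) (kacPetersonS (n + 2) k l' m)) := by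
    intro m
    rw [kacPetersonS_rotateLabels, kacPetersonS_rotateLabels, map_mul, map_mul, conj_expTurn,
      neg_neg, map_intCast, expTurn_add]
    have h2 : ((Equiv.Perm.sign (finRotate (n + 2)) : ℤ) : ℂ) *
        ((Equiv.Perm.sign (finRotate (n + 2)) : ℤ) : ℂ) = 1 := by
      rw [← Int.cast_mul, ← Units.val_mul, Int.units_mul_self]
      simp
    linear_combination expTurn (-((betaSum l : ℝ) / (n + 2))) *
      expTurn ((betaSum l' : ℝ) / (n + 2)) * kacPetersonS (n + 2) k l m *
      (starRingEnd ℂ) (kacPetersonS (n + 2) k l' m) * h2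
  have h3 := hbij.sum_comp fun m =>
    kacPetersonS (n + 2) k l m * (starRingEnd ℂ) (kacPetersonS (n + 2) k l' m)
  simp only [h1, ← mul_sum] at h3
  by_contra hne
  obtain ⟨q, hq⟩ := (expTurn_eq_one_iff _).1 (mul_eq_right₀ hne |>.1 h3)
  apply h
  refine ⟨-q, ?_⟩
  have h5 : (n : ℝ) + 2 ≠ 0 := by positivity
  field_simp at hq
  have : (betaSum l : ℝ) - betaSum l' = (n + 2) * -q := by linarith
  exact_mod_cast this

theorem kacPetersonS_mul_conj_of_dvd {l l' : LevelWeight (n + 2) k} {q : ℤ}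
    (hq : (betaSum l : ℤ) - betaSum l' = (n + 2) * q) (m : LevelWeight (n + 2) k) :
    kacPetersonS (n + 2) k l m * (starRingEnd ℂ) (kacPetersonS (n + 2) k l' m) =
      (((n : ℂ) + 2) * ((k : ℂ) + n + 2) ^ (n + 1))⁻¹ *
        (charDet (fun j => betaResidue l j - (q : ZMod (k + n + 2))) (betaResidue m) *
          (starRingEnd ℂ) (charDet (betaResidue l') (betaResidue m))) := by
  have h1 : (q : ZMod (k + n + 2)) * ∑ j, betaResidue m j =
      ((q * betaSum m : ℤ) : ZMod (k + n + 2)) := by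
    simp [betaResidue, betaSum]
  have h2 : expTurn ((betaSum l : ℝ) * betaSum m / ((n + 2) * (k + n + 2))) *
      expTurn (-((betaSum l' : ℝ) * betaSum m / ((n + 2) * (k + n + 2)))) =
      expTurn (((q * betaSum m : ℤ) : ℝ) / ((k + n + 2 : ℕ) : ℝ)) := by
    have h3 : (betaSum l : ℝ) = betaSum l' + (n + 2) * q := by
      have : (betaSum l : ℝ) - betaSum l' = (n + 2) * q := by exact_mod_cast hq
      linarith
    have h4 : (k : ℝ) + n + 2 ≠ 0 := by positivity
    have h5 : (n : ℝ) + 2 ≠ 0 := by positivity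
    rw [← expTurn_add, h3]
    congr 1
    push_cast
    field_simp
    ring
  rw [charDet_sub_const, h1, stdAddChar_intCast, ← h2, ← kacPetersonConst_mul_conj,
    kacPetersonS_eq_charDet, kacPetersonS_eq_charDet, map_mul, map_mul, conj_expTurn]
  ring

theorem sum_kacPetersonS_mul_conj (l l' : LevelWeight (n + 2) k) :
    ∑ m, kacPetersonS (n + 2) k l m * (starRingEnd ℂ) (kacPetersonS (n + 2) k l' m) =
      if l = l' then 1 else 0 := by
  by_cases hdvd : ((n : ℤ) + 2) ∣ betaSum l - betaSum l'
  swap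
  · rw [sum_kacPetersonS_mul_conj_of_not_dvd hdvd, if_neg]
    rintro rfl
    simp at hdvd
  obtain ⟨q, hq⟩ := hdvd
  have hk : (k : ℂ) + n + 2 ≠ 0 := by exact_mod_cast (by omega : k + n + 2 ≠ 0)
  have hn : (n : ℂ) + 2 ≠ 0 := by exact_mod_cast (by omega : n + 2 ≠ 0)
  have hf : ((n + 1).factorial : ℂ) ≠ 0 := by exact_mod_cast (n + 1).factorial_ne_zero
  simp only [kacPetersonS_mul_conj_of_dvd hq, ← mul_sum]
  -- Translating `N` entries by `-q` removes exactly the difference `N q` of the totals.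
  have hsum : ∑ j, (betaResidue l j - (q : ZMod (k + n + 2))) = ∑ j, betaResidue l' j := by
    have h1 := congrArg (Int.cast : ℤ → ZMod (k + n + 2)) hq
    simp only [betaSum] at h1
    push_cast at h1
    rw [sum_sub_distrib]
    simp only [betaResidue, sum_const, card_univ, Fintype.card_fin, nsmul_eq_mul]
    push_cast
    linear_combination h1
  have hmain := sum_levelWeight_charDet_mul_conj (n := n) (k := k) hsum
  have hrigid : ∀ σ τ : Equiv.Perm (Fin (n + 2)),
      (fun j => betaResidue l j - (q : ZMod (k + n + 2))) ∘ σ = betaResidue l' ∘ τ →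
      q = 0 ∧ l = l' := by
    intro σ τ hστ
    have := eq_zero_and_eq_of_betaNumber_sub_modEq (n := n) (h := k + n + 2) (q := q) (σ := σ)
      (τ := τ) (betaNumber_lt l) (betaNumber_lt l') (by simpa [betaSum] using hq) (by
        intro j
        rw [← ZMod.intCast_zmod_eq_zero_iff_dvd]
        have := congrFun hστ j
        simp only [Function.comp_apply, betaResidue] at this
        push_cast
        rw [this, sub_self])
    exact ⟨this.1, Subtype.ext this.2.1⟩
  split_ifs with heq
  · subst heq
    have hq0 : q = 0 := by
      rw [sub_self] at hq
      exact (mul_eq_zero.1 hq.symm).resolve_left (by positivity)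
    subst hq0
    simp only [Int.cast_zero, sub_zero] at hmain ⊢
    rw [sum_charDet_mul_conj_self (betaResidue_injective l), Fintype.card_fin,
      Nat.factorial_succ (n + 1)] at hmain
    rw [inv_mul_eq_one₀ (by positivity)]
    -- With `h = k + N`, `h (N-1)!` times the sum is `h^N N!`, so the sum is `N h^(N-1)`, the
    -- inverse of the squared modulus of the normalisation.
    refine (mul_left_cancel₀ (mul_ne_zero hk hf) ?_).symm
    rw [hmain]
    push_cast
    ring
  · rw [sum_charDet_mul_conj_eq_zero fun σ τ h => heq (hrigid σ τ h).2] at hmain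
    rw [(mul_eq_zero.1 hmain).resolve_left (mul_ne_zero hk hf), mul_zero]

end Weights
end SuAffine

theorem mainTheorem4 (N k : ℕ) (hN : 2 ≤ N) :
    SuAffine.kacPetersonS N k ∈ Matrix.unitaryGroup (SuAffine.LevelWeight N k) ℂ ∧
    ∀ l n : SuAffine.LevelWeight N k,
      ∑ m, SuAffine.kacPetersonS N k l m *
          (starRingEnd ℂ) (SuAffine.kacPetersonS N k n m) =
        if l = n then 1 else 0 := by
  obtain ⟨n, rfl⟩ := Nat.exists_eq_add_of_le' hN
  refine ⟨?_, SuAffine.sum_kacPetersonS_mul_conj⟩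
  rw [Matrix.mem_unitaryGroup_iff]
  ext l l'
  rw [Matrix.mul_apply, Matrix.one_apply, ← SuAffine.sum_kacPetersonS_mul_conj l l']
  rfl
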